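/- Let $n\ge 3$ and assume Fröberg's Conjecture for forms of consecutive degrees in $n$ variables, i.e.: for all integers $1\le e\le d$, if $I\subset\mathbb{C}[x_1,\dots,x_n]$ is generated by $e$ general forms of degrees $d,d-1,\dots,d-e+1$, then $\dim_{\mathbb C}\,(\mathbb{C}[x_1,\dots,x_n]/I)_{d+1}$ equals the coefficient of $t^{d+1}$ in $$\left[\frac{\prod_{i=1}^{e}(1-t^{d+1-i})}{(1-t)^n}\right]_{>0},$$ where $[\sum a_it^i]_{>0}=\sum b_it^i$ with $b_i=a_i$ if $a_j>0$ for all $j\le i$, and $b_i=0$ otherwise. ("General" means: for all tuples of forms in a nonempty Zariski open set. In particular, the assumption holds if Fröberg's Conjecture holds for all ideals of general forms in $n$ variables.) For integers $d,e,m\ge 0$ let $\mathcal{T}^n_{d,e,m}$ be the Zariski closure in $\mathbb{P}^{\binom{n+m}{n}-1}_{\mathbb C}$ (the space of polynomials $\sum_{|\gamma|\le m}c_\gamma x^\gamma$ up to scaling) of the set of Taylor polynomials of order $m$ at $0$ of the rational functions $P/Q$ with $P,Q\in\mathbb{C}[x_1,\dots,x_n]$, $\deg P\le d$, $\deg Q\le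 e$, $P(0)=Q(0)=1$. Call $\mathcal{T}^n_{d,e,m}$ defective if $$\dim\mathcal{T}^n_{d,e,m}<\min\left\{\binom{d+n}{n}+\binom{e+n}{n}-2,\ \binom{m+n}{n}-1\right\}.$$ Then there are only finitely many pairs $(d,e)$ of nonnegative integers such that $\mathcal{T}^n_{d,e,d+1}$ is defective. -/

import Mathlib

noncomputable section

namespace TaylorVar

open MvPolynomial

/-! ### Projective varieties over the complex numbers -/

section Projective

variable {σ : Type}

/-- The affine cone, without its apex, over a set of points of projective space: all vectors of
homogeneous coordinates of points of `S`. -/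
def cone (S : Set (Projectivization ℂ (σ → ℂ))) : Set (σ → ℂ) :=
  {v | ∃ hv : v ≠ 0, Projectivization.mk ℂ v hv ∈ S}

/-- The homogeneous ideal of a (nonempty) set of points of projective space: all polynomials that
vanish at all vectors of homogeneous coordinates of all points of the set. -/
def projIdeal (S : Set (Projectivization ℂ (σ → ℂ))) : Ideal (MvPolynomial σ ℂ) :=
  vanishingIdeal ℂ (cone S)

/-- The Zariski closure in projective space. -/
def projClosure (S : Set (Projectivization ℂ (σ → ℂ))) : Set (Projectivization ℂ (σ → ℂ)) :=
  {x | ∀ (v : σ → ℂ) (hv : v ≠ 0), Projectivization.mk ℂ v hv = x →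
    v ∈ zeroLocus ℂ (projIdeal S)}

/-- The Krull dimension of the homogeneous coordinate ring of a set of points of projective space.
For a nonempty closed subset `X` of projective space this number is `dim X + 1`. -/
def coneDim (X : Set (Projectivization ℂ (σ → ℂ))) : WithBot ℕ∞ :=
  ringKrullDim (MvPolynomial σ ℂ ⧸ projIdeal X)

end Projective

/-! ### Taylor varieties -/

/-- Exponent vectors of the monomials of degree at most `m` in `n` variables. -/
abbrev Expo (n m : ℕ) : Type := {γ : Fin n →₀ ℕ // γ.degree ≤ m}

/-- The points `(c_γ)` of projective space given by the Taylor polynomials up to order `m` of the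
rational functions `P / Q` with `P(0) = Q(0) = 1`, `deg P ≤ d` and `deg Q ≤ e`. The quotient is
taken in the ring of formal power series. -/
def taylorPoints (n d e m : ℕ) : Set (Projectivization ℂ (Expo n m → ℂ)) :=
  {x | ∃ P Q : MvPolynomial (Fin n) ℂ,
    P.totalDegree ≤ d ∧ Q.totalDegree ≤ e ∧ constantCoeff P = 1 ∧ constantCoeff Q = 1 ∧
    ∃ (c : Expo n m → ℂ) (hc : c ≠ 0), Projectivization.mk ℂ c hc = x ∧
      ∀ γ : Expo n m, c γ =
        MvPowerSeries.coeff γ.1 ((P : MvPowerSeries (Fin n) ℂ) * (Q : MvPowerSeries (Fin n) ℂ)⁻¹)}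

/-- The Taylor variety: the closure in projective space of the set of Taylor polynomials. -/
def taylorVariety (n d e m : ℕ) : Set (Projectivization ℂ (Expo n m → ℂ)) :=
  projClosure (taylorPoints n d e m)

/-- The expected dimension of the Taylor variety. No subtraction truncates here, since all
binomial coefficients are at least `1`. -/
def expectedDim (n d e m : ℕ) : ℕ :=
  min ((d + n).choose n + (e + n).choose n - 2) ((m + n).choose n - 1)

/-- The Taylor variety is defective if its dimension is smaller than the expected dimension
(with `1` added on both sides, see `coneDim`). -/
def IsDefective (n d e m : ℕ) : Prop :=
  coneDim (taylorVariety n d e m) < ((expectedDim n d e m + 1 : ℕ) : WithBot ℕ∞)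

/-! ### Ideals of general forms -/

/-- `p` holds for general `r`-tuples of forms in `ℂ[x₁,…,xₙ]` of degrees `D 0, …, D (r-1)`: it holds
on a nonempty Zariski open subset `{Φ ≠ 0}` of the space of these tuples, where `Φ` is a polynomial
in the coefficients of the forms. -/
def ForGeneralForms (n : ℕ) {r : ℕ} (D : Fin r → ℕ)
    (p : (Fin r → MvPolynomial (Fin n) ℂ) → Prop) : Prop :=
  ∃ Φ : MvPolynomial (Fin r × (Fin n →₀ ℕ)) ℂ,
    (∃ F : Fin r → MvPolynomial (Fin n) ℂ, (∀ i, (F i).IsHomogeneous (D i)) ∧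
      eval (fun a => coeff a.2 (F a.1)) Φ ≠ 0) ∧
    ∀ F : Fin r → MvPolynomial (Fin n) ℂ, (∀ i, (F i).IsHomogeneous (D i)) →
      eval (fun a => coeff a.2 (F a.1)) Φ ≠ 0 → p F

/-- The Hilbert function of `ℂ[x₁,…,xₙ] / I` for a homogeneous ideal `I`: the dimension of the
image of the space of forms of degree `k`. -/
def hilbertFn {n : ℕ} (I : Ideal (MvPolynomial (Fin n) ℂ)) (k : ℕ) : ℕ :=
  Module.finrank ℂ
    ((homogeneousSubmodule (Fin n) ℂ k).map (Ideal.Quotient.mkₐ ℂ I).toLinearMap)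

/-- The power series `∏ᵢ (1 - t ^ D i) / (1 - t) ^ n`. -/
def frobergSeries (n : ℕ) {r : ℕ} (D : Fin r → ℕ) : PowerSeries ℤ :=
  (∏ i, (1 - (PowerSeries.X : PowerSeries ℤ) ^ D i)) * (PowerSeries.invOneSubPow ℤ n).val

open Classical in
/-- The operator `[∑ aᵢ tⁱ]_{>0} = ∑ bᵢ tⁱ`, where `bᵢ = aᵢ` if `aⱼ > 0` for all `j ≤ i`, and
`bᵢ = 0` otherwise. -/
def positivePart (f : PowerSeries ℤ) : PowerSeries ℤ :=
  PowerSeries.mk fun i => if ∀ j ≤ i, 0 < PowerSeries.coeff j f then PowerSeries.coeff i f else 0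

/-- Fröberg's Conjecture for forms of degrees `D 0, …, D (r-1)` in `n` variables, in degree `k`: the
Hilbert function of the ideal generated by general forms of these degrees takes in degree `k` the
value predicted by the truncated series. -/
def FrobergHolds (n : ℕ) {r : ℕ} (D : Fin r → ℕ) (k : ℕ) : Prop :=
  ForGeneralForms n D fun F =>
    (hilbertFn (Ideal.span (Set.range F)) k : ℤ) =
      PowerSeries.coeff k (positivePart (frobergSeries n D))

/-- Fröberg's Conjecture in `n` variables, for what concerns Taylor varieties: for `1 ≤ e ≤ d`, the
Hilbert function of an ideal generated by `e` general forms of degrees `d, d-1, …, d-e+1` takes in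
degree `d+1` the predicted value. (The full conjecture asserts the same for all lists of positive
degrees and in all degrees `k`, so it is formally stronger.) -/
def FrobergConsecutive (n : ℕ) : Prop :=
  ∀ d e : ℕ, 1 ≤ e → e ≤ d → FrobergHolds n (fun i : Fin e => d - (i : ℕ)) (d + 1)

end TaylorVar

end

noncomputable section

namespace TaylorVar

open MvPolynomial

/-! ### Krull dimension and algebraic independence -/

/-! On the cone over the Taylor points the coefficients `c` of degree at most `d` are free (up to `c
0 ≠ 0`), because the numerator is arbitrary. The part of degree `d + 1` is minus the tail of `q *
c`, with `q` the nonconstant part of the denominator. Hence the cone has dimension at least `(d +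
n).choose n` plus the rank of `tailMatrix e c₀` for any single `c₀` (`le_coneDim_taylorVariety`),
and nondefectivity follows once some `c₀` gives maximal rank.

Take `c₀` to be a sum of general forms of degrees `d, …, d - r + 1` with `r ≤ e`. The tails then
contain the degree `d + 1` part of the ideal of these forms, whose dimension is given by Fröberg. If
`2 * r ≤ d + 1`, the coefficient needed comes from the linear terms of the product alone. For `2 * e
≤ d + 1` take `r = e`. For larger `e ≤ d` take `r = (d + 1) / 2`: when `d` is large, this already
fills all of degree `d + 1` (`multichoose_lt_choose_half`). For `e > d`, `c₀ = 1` works. Only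
finitely many pairs remain. -/

theorem ringKrullDim_le_of_isIntegral_of_injective {R S : Type*} [CommRing R] [CommRing S]
    [Algebra R S] [Algebra.IsIntegral R S] [FaithfulSMul R S] :
    ringKrullDim R ≤ ringKrullDim S := by
  refine iSup_le fun l => ?_
  obtain ⟨P, hP, hl⟩ := Ideal.nonempty_primesOver (S := S) (l.head.asIdeal)
  obtain ⟨L, hL, -⟩ := Ideal.exists_ltSeries_of_hasGoingUp l P
  rw [← hL]
  exact Order.LTSeries.length_le_krullDim L

/-- Noether normalization makes `B` integral over a polynomial ring in `s` variables; comparing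
transcendence degrees bounds the number of variables by `s`. -/
theorem natCard_le_ringKrullDim_of_domain {k : Type} [Field k] {B : Type} [CommRing B] [IsDomain B]
    [Algebra k B] [Algebra.FiniteType k B] {ι : Type} [Finite ι]
    (f : MvPolynomial ι k →ₐ[k] B) (hf : Function.Injective f) :
    (Nat.card ι : WithBot ℕ∞) ≤ ringKrullDim B := by
  obtain ⟨s, g, hg, hint⟩ := exists_integral_inj_algHom_of_fg k B
  algebraize [g.toRingHom]
  have : FaithfulSMul (MvPolynomial (Fin s) k) B :=
    (faithfulSMul_iff_algebraMap_injective _ _).2 hg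
  have hdim : ringKrullDim (MvPolynomial (Fin s) k) = s := by simp
  have h1 : ringKrullDim (MvPolynomial (Fin s) k) ≤ ringKrullDim B :=
    ringKrullDim_le_of_isIntegral_of_injective
  have htr : Algebra.trdeg k B = Algebra.trdeg k (MvPolynomial (Fin s) k) := by
    have : IsScalarTower k (MvPolynomial (Fin s) k) B := IsScalarTower.of_algHom g
    have := trdeg_add_eq k (MvPolynomial (Fin s) k) (A := B)
    rw [← this, trdeg_eq_zero (R := MvPolynomial (Fin s) k) (A := B), add_zero]
  have h2 := trdeg_le_of_injective f hf
  rw [htr, MvPolynomial.trdeg_of_isDomain, MvPolynomial.trdeg_of_isDomain] at h2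
  have h3 : Nat.card ι ≤ s := by
    have := Fintype.ofFinite ι
    rw [Nat.card_eq_fintype_card]
    simpa using h2
  rw [hdim] at h1
  exact le_trans (by exact_mod_cast h3) h1

/-- Some prime of `A` contracts to zero along the injection; dividing by it reduces to a domain. -/
theorem natCard_le_ringKrullDim {k : Type} [Field k] {A : Type} [CommRing A]
    [Algebra k A] [Algebra.FiniteType k A] {ι : Type} [Finite ι]
    (f : MvPolynomial ι k →ₐ[k] A) (hf : Function.Injective f) :
    (Nat.card ι : WithBot ℕ∞) ≤ ringKrullDim A := by
  obtain ⟨p, hp, hpf⟩ := Ideal.exists_comap_eq_of_mem_minimalPrimes_of_injective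
    (f := f.toRingHom) hf ⊥ (by simp [IsDomain.minimalPrimes_eq_singleton_bot])
  refine le_trans (natCard_le_ringKrullDim_of_domain ((Ideal.Quotient.mkₐ k p).comp f) ?_)
    (ringKrullDim_quotient_le p)
  rw [injective_iff_map_eq_zero]
  intro a ha
  have : a ∈ p.comap f.toRingHom := Ideal.mem_comap.2 (Ideal.Quotient.eq_zero_iff_mem.1 ha)
  rwa [hpf] at this

/-! ### Counting monomials -/

/-- Exponent vectors of the monomials of degree `k` in `n` variables. -/
abbrev Top (n k : ℕ) : Type := {γ : Fin n →₀ ℕ // γ.degree = k}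

instance (n m : ℕ) : Finite (Expo n m) := (Finsupp.finite_of_degree_le m).to_subtype

instance (n m : ℕ) : Finite (Top n m) :=
  ((Finsupp.finite_of_degree_le m).subset fun _ h => le_of_eq h).to_subtype

instance (n m : ℕ) : Fintype (Expo n m) := Fintype.ofFinite _

instance (n m : ℕ) : Fintype (Top n m) := Fintype.ofFinite _

theorem card_top (n k : ℕ) : Nat.card (Top n k) = n.multichoose k := by
  have : ∀ γ : Fin n →₀ ℕ, γ.degree = k ↔ γ ∈ Finset.univ.finsuppAntidiag k := by
    intro γ
    simp [Finset.mem_finsuppAntidiag, Finsupp.degree_eq_sum]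
  rw [Nat.card_congr (Equiv.subtypeEquivRight this), Nat.card_eq_fintype_card, Fintype.card_coe,
    Finset.card_finsuppAntidiag_nat_eq_multichoose, Finset.card_univ, Fintype.card_fin]

theorem card_expo (n m : ℕ) : Nat.card (Expo n m) = (m + n).choose n := by
  rw [← Nat.sum_range_multichoose, Nat.card_eq_fintype_card]
  have h := Finset.card_eq_sum_card_fiberwise (s := (Finset.univ : Finset (Expo n m)))
    (f := fun γ => γ.1.degree) (t := Finset.range (m + 1))
    (fun γ _ => by simpa [Nat.lt_succ_iff] using γ.2)
  rw [← Finset.card_univ, h]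
  refine Finset.sum_congr rfl fun k hk => ?_
  rw [← card_top, Nat.card_eq_fintype_card, ← Finset.card_univ]
  have hk' : k ≤ m := by simpa [Nat.lt_succ_iff] using hk
  refine Finset.card_bij' (fun γ _ => ⟨γ.1, ?_⟩) (fun γ _ => ⟨γ.1, γ.2.trans_le hk'⟩) ?_ ?_ ?_ ?_
  · simp_all
  all_goals simp

theorem multichoose_add_choose (n d : ℕ) :
    (d + n).choose n + n.multichoose (d + 1) = (d + 1 + n).choose n := by
  rw [← Nat.sum_range_multichoose, ← Nat.sum_range_multichoose, Finset.sum_range_succ _ (d + 1)]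

/-! ### Asymptotics -/

theorem descFactorial_two_mul_add_le (a n k : ℕ) (hk : k ≤ n + 1) :
    (2 * a + n).descFactorial k ≤ 2 ^ k * (a + n).descFactorial k := by
  induction k with
  | zero => simp
  | succ k ih =>
    rw [Nat.descFactorial_succ, Nat.descFactorial_succ, pow_succ]
    calc (2 * a + n - k) * (2 * a + n).descFactorial k
        ≤ (2 * (a + n - k)) * (2 ^ k * (a + n).descFactorial k) :=
          Nat.mul_le_mul (by omega) (ih (by omega))
      _ = _ := by ring

theorem choose_two_mul_add_le (a n k : ℕ) (hk : k ≤ n + 1) :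
    (2 * a + n).choose k ≤ 2 ^ k * (a + n).choose k := by
  have h := descFactorial_two_mul_add_le a n k hk
  rw [Nat.descFactorial_eq_factorial_mul_choose, Nat.descFactorial_eq_factorial_mul_choose] at h
  refine le_of_mul_le_mul_left (a := k.factorial) ?_ k.factorial_pos
  linarith

/-- The left side grows like `d ^ (n - 1)`, the right side like `d ^ n`. With `a = (d + 1) / 2` and
`n = k + 1`, halving the argument costs a factor `2 ^ k`, while passing from lower index `k` to `k +
1` gains `(a + 1) / (k + 1)`. -/
theorem multichoose_lt_choose_half (n d : ℕ) (hn : 1 ≤ n) (hd : n * 2 ^ n ≤ (d + 1) / 2) :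
    n.multichoose (d + 1) + 1 ≤ ((d + 1) / 2 + n).choose n := by
  obtain ⟨k, rfl⟩ : ∃ k, n = k + 1 := ⟨n - 1, by omega⟩
  set a := (d + 1) / 2 with ha
  have h1 : (k + 1).multichoose (d + 1) = (d + (k + 1)).choose k := by
    rw [Nat.multichoose_eq, Nat.choose_symm_of_eq_add]
    · congr 1; omega
    · omega
  have h2 : (d + (k + 1)).choose k ≤ 2 ^ k * (a + (k + 1)).choose k :=
    (Nat.choose_le_choose k (by omega)).trans (choose_two_mul_add_le a (k + 1) k (by omega))
  have h3 := Nat.choose_succ_right_eq (a + (k + 1)) k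
  have h4 : a + (k + 1) - k = a + 1 := by omega
  rw [h4] at h3
  rw [h1]
  have h5 : 0 < (a + (k + 1)).choose k := Nat.choose_pos (by omega)
  have h6 : 1 ≤ 2 ^ k := Nat.one_le_two_pow
  refine le_of_mul_le_mul_right (a := k + 1) ?_ (by omega)
  rw [h3]
  rw [pow_succ] at hd
  set x := (a + (k + 1)).choose k
  calc ((d + (k + 1)).choose k + 1) * (k + 1) ≤ (2 ^ k * x + 2 ^ k * x) * (k + 1) := by
        gcongr
        nlinarith
    _ = x * ((k + 1) * (2 ^ k * 2)) := by ring
    _ ≤ x * (a + 1) := by gcongr; omega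

/-! ### A lower bound for the dimension of a Taylor variety -/

/-- The polynomial with a given vector of coefficients. -/
def ofExpo {n d : ℕ} (c : Expo n d → ℂ) : MvPolynomial (Fin n) ℂ := ∑ γ, monomial γ.1 (c γ)

/-- The zero exponent vector. -/
def zeroExpo (n d : ℕ) : Expo n d := ⟨0, by simp⟩

theorem coeff_ofExpo {n d : ℕ} (c : Expo n d → ℂ) (γ : Fin n →₀ ℕ) :
    coeff γ (ofExpo c) = if h : γ.degree ≤ d then c ⟨γ, h⟩ else 0 := by
  rw [ofExpo, coeff_sum]
  simp only [coeff_monomial]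
  split_ifs with h
  · rw [Finset.sum_eq_single ⟨γ, h⟩]
    · simp
    · rintro ⟨b, hb⟩ - hne
      rw [if_neg]
      rintro rfl
      exact hne rfl
    · simp
  · refine Finset.sum_eq_zero fun b _ => if_neg ?_
    rintro rfl
    exact h b.2

theorem totalDegree_ofExpo_le {n d : ℕ} (c : Expo n d → ℂ) : (ofExpo c).totalDegree ≤ d := by
  refine totalDegree_finsetSum_le fun γ _ => (totalDegree_monomial_le _ _).trans ?_
  simpa [Finsupp.degree_eq_sum, Finsupp.sum_fintype] using γ.2

theorem coeff_ofExpo_mul {n e : ℕ} (q : Expo n e → ℂ) (p : MvPolynomial (Fin n) ℂ)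
    (γ : Fin n →₀ ℕ) :
    coeff γ (ofExpo q * p) = ∑ β : Expo n e, if β.1 ≤ γ then q β * coeff (γ - β.1) p else 0 := by
  rw [ofExpo, Finset.sum_mul, coeff_sum]
  exact Finset.sum_congr rfl fun β _ => coeff_monomial_mul' _ _ _ _

/-- A vector whose Taylor series is annihilated in degree `d + 1` by a denominator lies on the cone
over the set of Taylor polynomials. -/
theorem mem_cone_taylorPoints {n d e : ℕ} (v : Expo n (d + 1) → ℂ) (hv : v (zeroExpo n _) ≠ 0)
    (Q : MvPolynomial (Fin n) ℂ) (hQ : Q.totalDegree ≤ e) (hQ0 : constantCoeff Q = 1)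
    (h : ∀ γ : Fin n →₀ ℕ, γ.degree = d + 1 → coeff γ (Q * ofExpo v) = 0) :
    v ∈ cone (taylorPoints n d e (d + 1)) := by
  have hvne : v ≠ 0 := fun h0 => hv (by simp [h0])
  set a := v (zeroExpo n _) with ha
  set W : MvPolynomial (Fin n) ℂ := C a⁻¹ * ofExpo v with hW
  set P : MvPolynomial (Fin n) ℂ := ofExpo (fun γ : Expo n d => coeff γ.1 (Q * W)) with hP
  have hW0 : constantCoeff W = 1 := by
    have : coeff 0 (ofExpo v) = a := by
      rw [coeff_ofExpo, dif_pos (by simp)]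
      rfl
    rw [hW, map_mul, constantCoeff_C, constantCoeff_eq, this, inv_mul_cancel₀ hv]
  refine ⟨hvne, P, Q, totalDegree_ofExpo_le _, hQ, ?_, hQ0, a⁻¹ • v,
    smul_ne_zero (inv_ne_zero hv) hvne, ?_, ?_⟩
  · rw [constantCoeff_eq, hP, coeff_ofExpo, dif_pos (by simp)]
    rw [← constantCoeff_eq, map_mul, hQ0, hW0, one_mul]
  · rw [Projectivization.mk_eq_mk_iff']
    exact ⟨a⁻¹, rfl⟩
  · have hH : ∀ γ : Fin n →₀ ℕ, γ.degree ≤ d + 1 → coeff γ (Q * W - P) = 0 := by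
      intro γ hγ
      rw [coeff_sub, hP, coeff_ofExpo]
      split_ifs with h'
      · simp
      · have : coeff γ (Q * W) = 0 := by
          rw [hW, mul_left_comm, coeff_C_mul, h γ (by omega), mul_zero]
        rw [this, sub_zero]
    have hQ0' : MvPowerSeries.constantCoeff (Q : MvPowerSeries (Fin n) ℂ) ≠ 0 := by
      have : MvPowerSeries.constantCoeff (Q : MvPowerSeries (Fin n) ℂ) = 1 := by
        rw [← MvPowerSeries.coeff_zero_eq_constantCoeff_apply, coeff_coe, ← constantCoeff_eq, hQ0]
      rw [this]
      exact one_ne_zero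
    have key : (W : MvPowerSeries (Fin n) ℂ) =
        P * (Q : MvPowerSeries (Fin n) ℂ)⁻¹ +
          ((Q * W - P : MvPolynomial (Fin n) ℂ) : MvPowerSeries (Fin n) ℂ) *
            (Q : MvPowerSeries (Fin n) ℂ)⁻¹ := by
      have hsub : ((Q * W - P : MvPolynomial (Fin n) ℂ) : MvPowerSeries (Fin n) ℂ) =
          Q * W - P := by
        rw [eq_sub_iff_add_eq, ← coe_add, sub_add_cancel, coe_mul]
      rw [hsub, ← add_mul, add_sub_cancel, mul_right_comm,
        MvPowerSeries.mul_inv_cancel _ hQ0', one_mul]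
    intro γ
    have hz : MvPowerSeries.coeff γ.1
        (((Q * W - P : MvPolynomial (Fin n) ℂ) : MvPowerSeries (Fin n) ℂ) *
            (Q : MvPowerSeries (Fin n) ℂ)⁻¹) = 0 := by
      classical
      rw [MvPowerSeries.coeff_mul]
      refine Finset.sum_eq_zero fun x hx => ?_
      rw [coeff_coe, hH, zero_mul]
      have := γ.2
      rw [← Finset.HasAntidiagonal.mem_antidiagonal.1 hx, map_add] at this
      omega
    have := congrArg (MvPowerSeries.coeff γ.1) key
    rw [map_add, hz, add_zero, coeff_coe] at this
    rw [← this, hW, coeff_C_mul, coeff_ofExpo, dif_pos γ.2]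
    rfl

/-- The matrix of the linear map that sends a polynomial `q` of degree at most `e` to the part of
degree `d + 1` of `q * f`, where `f` is the polynomial with coefficient vector `c`. -/
def tailMatrix {n d : ℕ} (e : ℕ) {R : Type} [CommRing R] (c : Expo n d → R) :
    Matrix (Top n (d + 1)) (Expo n e) R :=
  Matrix.of fun γ β =>
    if β.1 ≤ γ.1 then (if h : (γ.1 - β.1).degree ≤ d then c ⟨γ.1 - β.1, h⟩ else 0) else 0

theorem tailMatrix_map {n d : ℕ} (e : ℕ) {R S : Type} [CommRing R] [CommRing S] (f : R →+* S)
    (c : Expo n d → R) : (tailMatrix e c).map f = tailMatrix e (f ∘ c) := by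
  ext γ β
  simp only [tailMatrix, Matrix.map_apply, Matrix.of_apply]
  split_ifs <;> simp

theorem tailMatrix_mulVec {n d e : ℕ} (c : Expo n d → ℂ) (q : Expo n e → ℂ)
    (γ : Top n (d + 1)) :
    (tailMatrix e c).mulVec q γ = coeff γ.1 (ofExpo q * ofExpo c) := by
  rw [coeff_ofExpo_mul]
  refine Finset.sum_congr rfl fun β _ => ?_
  simp only [tailMatrix, Matrix.of_apply, coeff_ofExpo]
  split_ifs <;> simp [mul_comm]

theorem degree_tsub_of_le {n : ℕ} {β γ : Fin n →₀ ℕ} (h : β ≤ γ) :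
    (γ - β).degree + β.degree = γ.degree := by
  rw [← map_add, tsub_add_cancel_of_le h]

/-- The Taylor coefficients up to order `d + 1` determined by those up to order `d` and the
denominator. -/
def extendTaylor {n d e : ℕ} (c : Expo n d → ℂ) (q : Expo n e → ℂ) : Expo n (d + 1) → ℂ :=
  fun γ => if h : γ.1.degree ≤ d then c ⟨γ.1, h⟩
    else -(tailMatrix e c).mulVec q ⟨γ.1, le_antisymm γ.2 (not_le.1 h)⟩

/-- The constant term of `q` never meets the tail, since `c` has no coefficient of degree `d + 1`;
it may therefore be reset to `1` to give the denominator. -/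
theorem extendTaylor_mem_cone {n d e : ℕ} (c : Expo n d → ℂ) (q : Expo n e → ℂ)
    (hc : c (zeroExpo n d) ≠ 0) : extendTaylor c q ∈ cone (taylorPoints n d e (d + 1)) := by
  classical
  refine mem_cone_taylorPoints _ ?_ (ofExpo (Function.update q (zeroExpo n e) 1))
    (totalDegree_ofExpo_le _) ?_ ?_
  · rw [extendTaylor, dif_pos (by simp [zeroExpo])]
    exact hc
  · rw [constantCoeff_eq, coeff_ofExpo, dif_pos (by simp)]
    exact Function.update_self (zeroExpo n e) _ _
  · intro γ hγ
    rw [coeff_ofExpo_mul, ← Finset.add_sum_erase _ _ (Finset.mem_univ (zeroExpo n e))]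
    have h1 : coeff γ (ofExpo (extendTaylor c q)) = -coeff γ (ofExpo q * ofExpo c) := by
      rw [coeff_ofExpo, dif_pos hγ.le, extendTaylor, dif_neg (by simp [hγ]), tailMatrix_mulVec]
    have h2 : coeff γ (ofExpo c) = 0 := by rw [coeff_ofExpo, dif_neg (by omega)]
    have h0 : (zeroExpo n e).1 = 0 := rfl
    rw [Function.update_self, h0, if_pos (zero_le), tsub_zero, h1, coeff_ofExpo_mul,
      ← Finset.add_sum_erase _ _ (Finset.mem_univ (zeroExpo n e)), h0, if_pos (zero_le),
      tsub_zero, h2, mul_zero, zero_add, one_mul, neg_add_eq_zero]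
    refine Finset.sum_congr rfl fun β hβ => ?_
    have hβ0 : β ≠ zeroExpo n e := Finset.ne_of_mem_erase hβ
    rw [Function.update_of_ne hβ0]
    refine if_ctx_congr Iff.rfl (fun hle => ?_) fun _ => rfl
    have hd := degree_tsub_of_le hle
    have hpos : β.1.degree ≠ 0 := by
      rw [Ne, Finsupp.degree_eq_zero_iff]
      exact fun h => hβ0 (Subtype.ext h)
    rw [coeff_ofExpo, coeff_ofExpo, dif_pos (by omega), dif_pos (by omega), extendTaylor,
      dif_pos (by simp only; omega)]

/-- Turns a rank bound into a nonzero determinant, which is a polynomial condition when `M` varies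
with `A` and `B` fixed. -/
theorem exists_mul_mul_eq_one_of_le_rank {ι κ : Type} [Fintype ι] [Fintype κ] {K : Type} [Field K]
    (M : Matrix ι κ K) (r : ℕ) (hr : r ≤ M.rank) :
    ∃ (A : Matrix (Fin r) ι K) (B : Matrix κ (Fin r) K), A * M * B = 1 := by
  classical
  obtain ⟨w, hw⟩ := exists_linearIndependent_of_le_finrank (M := LinearMap.range M.mulVecLin) hr
  choose u hu using fun i => (w i).2
  have hinj : LinearMap.ker (Fintype.linearCombination K fun i => (w i : ι → K)) = ⊥ := by
    rw [LinearMap.ker_eq_bot]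
    exact (hw.map' (Submodule.subtype _) (Submodule.ker_subtype _)).fintypeLinearCombination_injective
  obtain ⟨g, hg⟩ := LinearMap.exists_leftInverse_of_injective _ hinj
  refine ⟨LinearMap.toMatrix' g, (Matrix.of u).transpose, ?_⟩
  have : M * (Matrix.of u).transpose =
      LinearMap.toMatrix' (Fintype.linearCombination K fun i => (w i : ι → K)) := by
    ext i k
    rw [LinearMap.toMatrix'_apply, Fintype.linearCombination_apply_single, one_smul, ← hu]
    rfl
  rw [Matrix.mul_assoc, this, ← LinearMap.toMatrix'_comp, hg, LinearMap.toMatrix'_id]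

theorem le_coneDim_taylorVariety {n d e : ℕ} (c₀ : Expo n d → ℂ) (r : ℕ)
    (hr : r ≤ (tailMatrix e c₀).rank) :
    (((d + n).choose n + r : ℕ) : WithBot ℕ∞) ≤ coneDim (taylorVariety n d e (d + 1)) := by
  obtain ⟨A, B, hAB⟩ := exists_mul_mul_eq_one_of_le_rank _ r hr
  set S := taylorPoints n d e (d + 1) with hS
  let ψ : MvPolynomial (Expo n d ⊕ Fin r) ℂ →ₐ[ℂ] MvPolynomial (Expo n (d + 1)) ℂ :=
    aeval (Sum.elim (fun γ => X ⟨γ.1, γ.2.trans d.le_succ⟩)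
      (fun k => ∑ γ : Top n (d + 1), C (A k γ) * X ⟨γ.1, γ.2.le⟩))
  have hψ : ∀ (c : Expo n d → ℂ) (q : Expo n e → ℂ) (G : MvPolynomial (Expo n d ⊕ Fin r) ℂ),
      eval (extendTaylor c q) (ψ G) =
        eval (Sum.elim c (A.mulVec (-(tailMatrix e c).mulVec q))) G := by
    intro c q G
    simp only [ψ, aeval_def, ← coe_eval₂Hom]
    rw [← RingHom.comp_apply]
    refine congrFun (congrArg DFunLike.coe ?_) G
    refine ringHom_ext (by simp) ?_
    rintro (γ | k)
    · simp [extendTaylor, γ.2]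
    · have hx : ∀ x : Top n (d + 1), ¬ x.1.degree ≤ d := fun x => by
        rw [x.2]
        omega
      simp [extendTaylor, Matrix.mulVec, dotProduct, hx]
  have hcone : cone S ⊆ cone (taylorVariety n d e (d + 1)) := by
    rintro v ⟨hv, hvS⟩
    refine ⟨hv, fun w hw hwv p hp => ?_⟩
    refine hp w ⟨hw, ?_⟩
    rw [hwv]
    exact hvS
  let f := (Ideal.Quotient.mkₐ ℂ (projIdeal (taylorVariety n d e (d + 1)))).comp ψ
  have hf : Function.Injective f := by
    rw [injective_iff_map_eq_zero]
    intro G hG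
    have hG' : ψ G ∈ projIdeal (taylorVariety n d e (d + 1)) := Ideal.Quotient.eq_zero_iff_mem.1 hG
    let Δ : MvPolynomial (Expo n d) ℂ :=
      Matrix.det (A.map (C : ℂ → MvPolynomial (Expo n d) ℂ) *
        tailMatrix e (X : Expo n d → MvPolynomial (Expo n d) ℂ) *
        B.map (C : ℂ → MvPolynomial (Expo n d) ℂ))
    have hΔ : ∀ c, eval c Δ = (A * tailMatrix e c * B).det := by
      intro c
      have hC : (eval c : MvPolynomial (Expo n d) ℂ →+* ℂ) ∘ C = id := by ext; simp
      have hX : (eval c : MvPolynomial (Expo n d) ℂ →+* ℂ) ∘ X = c := by ext; simp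
      simp only [Δ]
      rw [RingHom.map_det, RingHom.mapMatrix_apply, Matrix.map_mul, Matrix.map_mul,
        tailMatrix_map, Matrix.map_map, Matrix.map_map, hC, hX, Matrix.map_id, Matrix.map_id]
    have hΔ0 : Δ ≠ 0 := by
      intro h
      have := hΔ c₀
      rw [h, hAB] at this
      simp at this
    have hne : rename (Sum.inl : _ → Expo n d ⊕ Fin r) (Δ * X (zeroExpo n d)) ≠ 0 := by
      rw [Ne, map_eq_zero_iff _ (rename_injective _ Sum.inl_injective)]
      exact mul_ne_zero hΔ0 (X_ne_zero _)
    -- Where `Δ` and the constant coefficient are nonzero, a suitable `q` realizes any prescribed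
    -- values of the `r` combinations of top coefficients, so `G` vanishes there. The product thus
    -- vanishes everywhere.
    refine (mul_eq_zero.1 (?_ : G * rename Sum.inl (Δ * X (zeroExpo n d)) = 0)).resolve_right hne
    refine MvPolynomial.funext fun w => ?_
    rw [map_mul, map_zero, eval_rename, map_mul, eval_X, hΔ, mul_eq_zero, or_iff_not_imp_right]
    intro hw
    obtain ⟨hdet, hw0⟩ := mul_ne_zero_iff.1 hw
    set c := w ∘ Sum.inl with hc
    have hmem := hG' _ (hcone (extendTaylor_mem_cone c
      (B.mulVec ((A * tailMatrix e c * B)⁻¹.mulVec (-(w ∘ Sum.inr)))) hw0))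
    rw [aeval_eq_eval, hψ] at hmem
    have : A.mulVec (-(tailMatrix e c).mulVec
        (B.mulVec ((A * tailMatrix e c * B)⁻¹.mulVec (-(w ∘ Sum.inr))))) = w ∘ Sum.inr := by
      rw [Matrix.mulVec_neg, Matrix.mulVec_mulVec, Matrix.mulVec_mulVec, Matrix.mulVec_mulVec,
        Matrix.mul_nonsing_inv _ (Ne.isUnit hdet),
        Matrix.one_mulVec, neg_neg]
    rwa [this, hc, Sum.elim_comp_inl_inr] at hmem
  have := natCard_le_ringKrullDim f hf
  rwa [Nat.card_sum, card_expo, Nat.card_fin] at this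

/-! ### Tails of products and ideals of forms -/

theorem ofExpo_coeff {n d : ℕ} (p : MvPolynomial (Fin n) ℂ) (hp : p.totalDegree ≤ d) :
    ofExpo (fun γ : Expo n d => coeff γ.1 p) = p := by
  ext γ
  rw [coeff_ofExpo]
  split_ifs with h
  · rfl
  · refine (coeff_eq_zero_of_totalDegree_lt ?_).symm
    refine hp.trans_lt ?_
    simpa [Finsupp.degree_apply] using h

/-- The form of degree `k` with a given vector of coefficients. -/
def formOfCoeffs (n k : ℕ) : (Top n k → ℂ) →ₗ[ℂ] MvPolynomial (Fin n) ℂ :=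
  ∑ γ : Top n k, (monomial γ.1).comp (LinearMap.proj γ)

theorem formOfCoeffs_apply {n k : ℕ} (t : Top n k → ℂ) :
    formOfCoeffs n k t = ∑ γ, monomial γ.1 (t γ) := by
  simp [formOfCoeffs]

theorem coeff_formOfCoeffs {n k : ℕ} (t : Top n k → ℂ) (γ : Top n k) :
    coeff γ.1 (formOfCoeffs n k t) = t γ := by
  rw [formOfCoeffs_apply, coeff_sum, Finset.sum_eq_single γ]
  · simp
  · intro b _ hb
    rw [coeff_monomial, if_neg fun h => hb (Subtype.ext h)]
  · simp

theorem range_formOfCoeffs (n k : ℕ) :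
    LinearMap.range (formOfCoeffs n k) = homogeneousSubmodule (Fin n) ℂ k := by
  apply le_antisymm
  · rintro _ ⟨t, rfl⟩
    rw [formOfCoeffs_apply]
    refine Submodule.sum_mem _ fun γ _ => ?_
    exact isHomogeneous_monomial _ γ.2
  · intro p hp
    rw [mem_homogeneousSubmodule] at hp
    refine ⟨fun γ => coeff γ.1 p, ?_⟩
    ext γ
    by_cases h : γ.degree = k
    · exact coeff_formOfCoeffs _ ⟨γ, h⟩
    · rw [hp.coeff_eq_zero h, formOfCoeffs_apply, coeff_sum]
      refine Finset.sum_eq_zero fun b _ => ?_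
      rw [coeff_monomial, if_neg]
      rintro rfl
      exact h b.2

theorem coeff_homogeneousComponent_mul {n k l : ℕ} (a : MvPolynomial (Fin n) ℂ)
    {F : MvPolynomial (Fin n) ℂ} (hF : F.IsHomogeneous l) (γ : Fin n →₀ ℕ)
    (hγ : γ.degree = k + l) :
    coeff γ (homogeneousComponent k a * F) = coeff γ (a * F) := by
  classical
  rw [coeff_mul, coeff_mul]
  refine Finset.sum_congr rfl fun x hx => ?_
  rw [coeff_homogeneousComponent]
  split_ifs with h
  · rfl
  · rw [hF.coeff_eq_zero, mul_zero, mul_zero]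
    rw [← Finset.HasAntidiagonal.mem_antidiagonal.1 hx, map_add] at hγ
    omega

/-- The forms of degree `d + 1` in an ideal generated by forms of degrees `d, d - 1, …` are among
the tails of the multiples of the sum of these forms. -/
theorem exists_multichoose_le_rank_add_hilbertFn {n d e r : ℕ} (hr : r ≤ d) (hre : r ≤ e)
    (F : Fin r → MvPolynomial (Fin n) ℂ) (hF : ∀ i, (F i).IsHomogeneous (d - (i : ℕ))) :
    ∃ c : Expo n d → ℂ, n.multichoose (d + 1) ≤
      (tailMatrix e c).rank + hilbertFn (Ideal.span (Set.range F)) (d + 1) := by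
  set f := ∑ i, F i with hf
  have hfd : f.totalDegree ≤ d :=
    totalDegree_finsetSum_le fun i _ => (hF i).totalDegree_le.trans (Nat.sub_le _ _)
  refine ⟨fun γ => coeff γ.1 f, ?_⟩
  set M := tailMatrix e (fun γ : Expo n d => coeff γ.1 f) with hM
  set I := Ideal.span (Set.range F) with hI
  set T : (Top n (d + 1) → ℂ) →ₗ[ℂ] MvPolynomial (Fin n) ℂ ⧸ I :=
    (Ideal.Quotient.mkₐ ℂ I).toLinearMap.comp (formOfCoeffs n (d + 1)) with hT
  have h1 : hilbertFn I (d + 1) = Module.finrank ℂ (LinearMap.range T) := by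
    rw [hilbertFn, ← range_formOfCoeffs, hT, LinearMap.range_comp]
  have h2 := LinearMap.finrank_range_add_finrank_ker T
  rw [Module.finrank_fintype_fun_eq_card, ← Nat.card_eq_fintype_card, card_top] at h2
  have h3 : LinearMap.ker T ≤ LinearMap.range M.mulVecLin := by
    intro t ht
    have hmem : formOfCoeffs n (d + 1) t ∈ I := Ideal.Quotient.eq_zero_iff_mem.1 ht
    obtain ⟨a, ha⟩ := Ideal.mem_span_range_iff_exists_fun.1 hmem
    -- Degree `i + 1` complements the degree `d - i` of `F i`; cross terms with `j ≠ i` have degree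
    -- `i + 1 + d - j ≠ d + 1` and leave the tail.
    set q := ∑ i : Fin r, homogeneousComponent ((i : ℕ) + 1) (a i) with hq
    have hqe : q.totalDegree ≤ e := totalDegree_finsetSum_le fun i _ =>
      (homogeneousComponent_isHomogeneous _ _).totalDegree_le.trans (by omega)
    refine ⟨fun β => coeff β.1 q, funext fun γ => ?_⟩
    rw [Matrix.mulVecLin_apply, tailMatrix_mulVec, ofExpo_coeff q hqe, ofExpo_coeff f hfd,
      ← coeff_formOfCoeffs t γ, ← ha, hq, Finset.sum_mul, coeff_sum, coeff_sum]
    refine Finset.sum_congr rfl fun i _ => ?_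
    rw [hf, Finset.mul_sum, coeff_sum, Finset.sum_eq_single i]
    · exact coeff_homogeneousComponent_mul _ (hF i) _ (by rw [γ.2]; omega)
    · intro j _ hj
      refine ((homogeneousComponent_isHomogeneous _ _).mul (hF j)).coeff_eq_zero ?_
      rw [γ.2]
      have : (i : ℕ) ≠ j := fun h => hj (Fin.ext h.symm)
      omega
    · simp
  have h4 : Module.finrank ℂ (LinearMap.ker T) ≤ M.rank := Submodule.finrank_mono h3
  omega

theorem exists_le_rank_of_lt (n : ℕ) {d e : ℕ} (h : d < e) :
    ∃ c : Expo n d → ℂ, n.multichoose (d + 1) ≤ (tailMatrix e c).rank := by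
  refine ⟨fun γ => coeff γ.1 1, ?_⟩
  rw [Matrix.rank, LinearMap.range_eq_top.2, finrank_top, Module.finrank_fintype_fun_eq_card,
    ← Nat.card_eq_fintype_card, card_top]
  intro t
  refine ⟨fun β => coeff β.1 (formOfCoeffs n (d + 1) t), funext fun γ => ?_⟩
  have ht : (formOfCoeffs n (d + 1) t).IsHomogeneous (d + 1) := by
    rw [← mem_homogeneousSubmodule, ← range_formOfCoeffs]
    exact ⟨t, rfl⟩
  rw [Matrix.mulVecLin_apply, tailMatrix_mulVec, ofExpo_coeff _ (ht.totalDegree_le.trans h),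
    ofExpo_coeff _ (by simp), mul_one, coeff_formOfCoeffs]

/-! ### Numerics of the Fröberg series -/

/-- Two distinct exponents `d - i` with `i < e` sum to at least `2 * d - 2 * e + 3 ≥ d + 2`, so only
constant and linear terms survive. -/
theorem X_pow_dvd_prod_sub {d e : ℕ} (he : 2 * e ≤ d + 1) (k : ℕ) (hk : k ≤ e) :
    (PowerSeries.X : PowerSeries ℤ) ^ (d + 2) ∣
      ∏ i ∈ Finset.range k, (1 - (PowerSeries.X : PowerSeries ℤ) ^ (d - i)) -
        (1 - ∑ i ∈ Finset.range k, (PowerSeries.X : PowerSeries ℤ) ^ (d - i)) := by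
  induction k with
  | zero => simp
  | succ k ih =>
    rw [Finset.prod_range_succ, Finset.sum_range_succ]
    set P := ∏ i ∈ Finset.range k, (1 - (PowerSeries.X : PowerSeries ℤ) ^ (d - i))
    have h1 : (PowerSeries.X : PowerSeries ℤ) ^ (d + 2) ∣
        (∑ i ∈ Finset.range k, (PowerSeries.X : PowerSeries ℤ) ^ (d - i)) *
          PowerSeries.X ^ (d - k) := by
      rw [Finset.sum_mul]
      refine Finset.dvd_sum fun i hi => ?_
      rw [← pow_add]
      have := Finset.mem_range.1 hi
      exact pow_dvd_pow _ (by omega)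
    convert dvd_add ((ih (by omega)).mul_right (1 - PowerSeries.X ^ (d - k))) h1 using 1
    ring

theorem coeff_invOneSubPow {n : ℕ} (hn : 1 ≤ n) (k : ℕ) :
    PowerSeries.coeff k (PowerSeries.invOneSubPow ℤ n).val = (n.multichoose k : ℤ) := by
  rw [PowerSeries.invOneSubPow_val_eq_mk_sub_one_add_choose_of_pos ℤ n hn, PowerSeries.coeff_mk,
    Nat.multichoose_eq, Nat.choose_symm_of_eq_add (n := n + k - 1) (a := k) (b := n - 1) (by omega)]
  congr 2
  omega

theorem coeff_frobergSeries {n d e : ℕ} (hn : 1 ≤ n) (he : 2 * e ≤ d + 1) :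
    PowerSeries.coeff (d + 1) (frobergSeries n fun i : Fin e => d - (i : ℕ)) =
      n.multichoose (d + 1) - ((e + n).choose n - 1 : ℤ) := by
  rw [frobergSeries, Fin.prod_univ_eq_prod_range
    (fun i => 1 - (PowerSeries.X : PowerSeries ℤ) ^ (d - i)) e]
  obtain ⟨g, hg⟩ := X_pow_dvd_prod_sub he e le_rfl
  rw [sub_eq_iff_eq_add.1 hg, add_mul, map_add, mul_assoc, PowerSeries.coeff_X_pow_mul',
    if_neg (by omega), zero_add, sub_mul, one_mul, map_sub, coeff_invOneSubPow hn, Finset.sum_mul,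
    map_sum, ← Nat.sum_range_multichoose, Finset.sum_range_succ']
  congr 1
  push_cast
  rw [Nat.multichoose_zero_right, Nat.cast_one, add_sub_cancel_right]
  refine Finset.sum_congr rfl fun i hi => ?_
  have := Finset.mem_range.1 hi
  rw [PowerSeries.coeff_X_pow_mul', if_pos (by omega), coeff_invOneSubPow hn]
  congr 2
  omega

theorem FrobergConsecutive.exists_le_rank {n : ℕ} (hn : 1 ≤ n) (hF : FrobergConsecutive n)
    {d r e : ℕ} (hr1 : 1 ≤ r) (hr : 2 * r ≤ d + 1) (hre : r ≤ e) :
    ∃ c : Expo n d → ℂ,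
      min ((r + n).choose n - 1) (n.multichoose (d + 1)) ≤ (tailMatrix e c).rank := by
  obtain ⟨Φ, ⟨F, hFh, hF0⟩, hΦ⟩ := hF d r hr1 (by omega)
  obtain ⟨c, hc⟩ := exists_multichoose_le_rank_add_hilbertFn (by omega) hre F hFh
  refine ⟨c, ?_⟩
  have h := hΦ F hFh hF0
  rw [positivePart, PowerSeries.coeff_mk] at h
  -- If the series stays positive, its coefficient yields the first entry of the `min`; if it is
  -- truncated, the quotient vanishes in degree `d + 1` and the second entry results.
  split_ifs at h
  · rw [coeff_frobergSeries hn hr] at h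
    omega
  · omega

/-! ### Defective Taylor varieties -/

theorem not_isDefective_of_le_rank {n d e : ℕ} (c : Expo n d → ℂ)
    (h : min ((e + n).choose n - 1) (n.multichoose (d + 1)) ≤ (tailMatrix e c).rank) :
    ¬ IsDefective n d e (d + 1) := by
  rw [IsDefective, not_lt]
  refine le_trans ?_ (le_coneDim_taylorVariety c _ h)
  have h1 := multichoose_add_choose n d
  have h2 : 0 < (d + n).choose n := Nat.choose_pos (by omega)
  have h3 : 0 < (e + n).choose n := Nat.choose_pos (by omega)
  have : expectedDim n d e (d + 1) + 1 ≤
      (d + n).choose n + min ((e + n).choose n - 1) (n.multichoose (d + 1)) := by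
    rw [expectedDim]
    omega
  exact_mod_cast this

end TaylorVar

end

theorem theorem6p2 (n : ℕ) (hn : 3 ≤ n) (hF : TaylorVar.FrobergConsecutive n) :
    {p : ℕ × ℕ | TaylorVar.IsDefective n p.1 p.2 (p.1 + 1)}.Finite := by
  refine ((Set.finite_Iio (2 * (n * 2 ^ n))).prod
    (Set.finite_Iio (2 * (n * 2 ^ n)))).subset ?_
  rintro ⟨d, e⟩ hde
  by_contra hmem
  have hN : 1 ≤ n * 2 ^ n := Nat.mul_pos (by omega) (by positivity)
  obtain ⟨c, hc⟩ : ∃ c : TaylorVar.Expo n d → ℂ,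
      min ((e + n).choose n - 1) (n.multichoose (d + 1)) ≤ (TaylorVar.tailMatrix e c).rank := by
    rcases lt_or_ge d e with h | h
    · obtain ⟨c, hc⟩ := TaylorVar.exists_le_rank_of_lt n h
      exact ⟨c, (min_le_right _ _).trans hc⟩
    have hd : 2 * (n * 2 ^ n) ≤ d := by
      by_contra hd
      exact hmem ⟨by simp only [Set.mem_Iio]; omega, by simp only [Set.mem_Iio]; omega⟩
    rcases Nat.eq_zero_or_pos e with rfl | he
    · exact ⟨0, by simp⟩
    rcases le_total (2 * e) (d + 1) with h2 | h2
    · exact hF.exists_le_rank (by omega) he h2 le_rfl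
    -- The largest `r` with `2 * r ≤ d + 1`; for this `d` the `min` is already `n.multichoose (d +
    -- 1)`.
    · obtain ⟨c, hc⟩ := hF.exists_le_rank (d := d) (r := (d + 1) / 2) (e := e) (by omega)
        (by omega) (by omega) (by omega)
      have := TaylorVar.multichoose_lt_choose_half n d (by omega) (by omega)
      exact ⟨c, by omega⟩
  exact TaylorVar.not_isDefective_of_le_rank c hc hde
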